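/- For $\theta\in[0,2\pi)$ let $O(\theta)=\begin{bmatrix}\cos(\theta/2)&-\sin(\theta/2)\\ \sin(\theta/2)&\cos(\theta/2)\end{bmatrix}$ and, for $r\in[0,1]$, let $\rho(r,\theta)=O(\theta)\begin{bmatrix}r&0\\0&1-r\end{bmatrix}O(\theta)^\top$, a $2\times2$ density matrix. For $2\times 2$ density matrices $\rho^A,\rho^B$ let $\Gamma^Q(\rho^A,\rho^B)$ be the set of density matrices $R$ (positive semidefinite, trace one) on $\mathbb C^2\otimes\mathbb C^2$ whose partial traces over the second and the first factor are $\rho^A$ and $\rho^B$, respectively. Let $C^Q=\tfrac12(\mathbb I-S)$, where $S$ is the SWAP operator $x\otimes y\mapsto y\otimes x$, and let $$\mathrm T^Q_{C^Q}(\rho^A,\rho^B)=\min_{R\in\Gamma^Q(\rho^A,\rho^B)}\operatorname{tr}(C^QR).$$ Let $0<r,s<1$, $\theta\in[0,2\pi)$, $\rho^A=\rho(s,0)$ and $\rho^B=\rho(r,\theta)$. Then the minimum defining $\mathrm T^Q_{C^Q}(\rho^A,\rho^B)$ is attained and $$\mathrm T^Q_{C^Q}(\rho^A,\rho^B)=\max_{\phi\in\Phi(s,r,\theta)}\frac14\Big(\sqrt{1+(2s-1)\cos\phi}-\sqrt{1+(2r-1)\cos(\theta+\phi)}\Big)^2,$$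 where the maximum is attained and $\Phi(s,r,\theta)$ is the set of all $\phi\in[0,2\pi)$ satisfying $$\frac{(2s-1)^2\sin^2\phi}{1+(2s-1)\cos\phi}=\frac{(2r-1)^2\sin^2(\theta+\phi)}{1+(2r-1)\cos(\theta+\phi)}.\qquad(*)$$ Moreover, with $\zeta=e^{i\theta}$, a real number $\phi$ satisfies $(*)$ if and only if $z=e^{i\phi}$ is a root of $$P(z)=(1-2r)^2\big[(2s-1)(z^2+1)+2z\big](\zeta^2z^2-1)^2-\zeta(1-2s)^2(z^2-1)^2\big[(2r-1)(\zeta^2z^2+1)+2\zeta z\big],$$ a polynomial of degree at most $6$. If $\rho^A\neq\rho^B$, then $P\neq0$ and $\Phi(s,r,\theta)$ has at most six elements. -/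

import Mathlib

open scoped Matrix ComplexOrder

namespace QuantumTransport

/-- Density matrices: Hermitian positive semidefinite complex matrices of trace one. -/
def IsDensity {n : Type*} [Fintype n] (ρ : Matrix n n ℂ) : Prop :=
  ρ.PosSemidef ∧ ρ.trace = 1

/-- The partial trace over the second tensor factor. -/
def traceB {m n : Type*} [Fintype n] (R : Matrix (m × n) (m × n) ℂ) : Matrix m m ℂ :=
  Matrix.of fun i j => ∑ p, R (i, p) (j, p)

/-- The partial trace over the first tensor factor. -/
def traceA {m n : Type*} [Fintype m] (R : Matrix (m × n) (m × n) ℂ) : Matrix n n ℂ :=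
  Matrix.of fun p q => ∑ i, R (i, p) (i, q)

/-- The set of quantum couplings of `ρA` and `ρB`: bipartite density matrices whose
partial traces are `ρA` and `ρB`. -/
def couplings {m n : Type*} [Fintype m] [Fintype n]
    (ρA : Matrix m m ℂ) (ρB : Matrix n n ℂ) : Set (Matrix (m × n) (m × n) ℂ) :=
  {R | IsDensity R ∧ traceB R = ρA ∧ traceA R = ρB}

/-- The set of the transport costs `tr (C R)` of all couplings `R` of `ρA` and `ρB`.
For Hermitian `C` the number `tr (C R)` is real, so taking the real part loses nothing. -/
def costs {m n : Type*} [Fintype m] [Fintype n] (C : Matrix (m × n) (m × n) ℂ)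
    (ρA : Matrix m m ℂ) (ρB : Matrix n n ℂ) : Set ℝ :=
  (fun R => (C * R).trace.re) '' couplings ρA ρB

/-- The quantum optimal transport cost: the minimum of `tr (C R)` over all couplings. -/
noncomputable def transportCost {m n : Type*} [Fintype m] [Fintype n]
    (C : Matrix (m × n) (m × n) ℂ) (ρA : Matrix m m ℂ) (ρB : Matrix n n ℂ) : ℝ :=
  sInf (costs C ρA ρB)

/-- The SWAP operator, determined by `x ⊗ y ↦ y ⊗ x`. -/
def swapMatrix (n : Type*) [DecidableEq n] : Matrix (n × n) (n × n) ℂ :=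
  Matrix.of fun a b => if a = b.swap then 1 else 0

/-- The cost matrix `(1 - S) / 2`, the projection onto the skew-symmetric tensors. -/
noncomputable def swapCost (n : Type*) [DecidableEq n] : Matrix (n × n) (n × n) ℂ :=
  (1 / 2 : ℂ) • (1 - swapMatrix n)

/-- The rotation matrix by the angle `θ / 2`. -/
noncomputable def rot (θ : ℝ) : Matrix (Fin 2) (Fin 2) ℝ :=
  !![Real.cos (θ / 2), -Real.sin (θ / 2); Real.sin (θ / 2), Real.cos (θ / 2)]

/-- The qubit state `O(θ) diag(r, 1 - r) O(θ)ᵀ`. -/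
noncomputable def qubit (r θ : ℝ) : Matrix (Fin 2) (Fin 2) ℂ :=
  (rot θ * !![r, 0; 0, 1 - r] * (rot θ)ᵀ).map Complex.ofReal

/-- The trigonometric equation for the angle `φ`. For `0 < r, s < 1` both denominators
are positive. -/
def PhiEquation (s r θ φ : ℝ) : Prop :=
  (2 * s - 1) ^ 2 * Real.sin φ ^ 2 / (1 + (2 * s - 1) * Real.cos φ) =
    (2 * r - 1) ^ 2 * Real.sin (θ + φ) ^ 2 / (1 + (2 * r - 1) * Real.cos (θ + φ))

/-- The set of solutions of the trigonometric equation in `[0, 2π)`. -/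
def PhiSet (s r θ : ℝ) : Set ℝ :=
  {φ | φ ∈ Set.Ico 0 (2 * Real.pi) ∧ PhiEquation s r θ φ}

/-- The function of the angle `φ` that is maximized. -/
noncomputable def gFun (s r θ φ : ℝ) : ℝ :=
  1 / 4 * (√(1 + (2 * s - 1) * Real.cos φ) - √(1 + (2 * r - 1) * Real.cos (θ + φ))) ^ 2

open Polynomial in
/-- The polynomial in `z = exp (i φ)`, with `ζ = exp (i θ)`, equivalent to the trigonometric
equation. -/
noncomputable def phiPoly (s r θ : ℝ) : ℂ[X] :=
  let ζ : ℂ := Complex.exp (θ * Complex.I)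
  C ((1 - 2 * r : ℂ) ^ 2) * (C (2 * s - 1 : ℂ) * (X ^ 2 + 1) + 2 * X)
      * (C (ζ ^ 2) * X ^ 2 - 1) ^ 2
    - C (ζ * (1 - 2 * s : ℂ) ^ 2) * (X ^ 2 - 1) ^ 2
      * (C (2 * r - 1 : ℂ) * (C (ζ ^ 2) * X ^ 2 + 1) + C (2 * ζ) * X)

end QuantumTransport

namespace QuantumTransport

/-! ### The polynomial in `z = exp (i φ)`. -/

section Polynomial

open Polynomial

/-! The transport formula is a duality with no gap. For an angle `φ` let `x = (cos (φ/2), -sin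
(φ/2))` and let `y` be the orthogonal unit vector. The cost sees only the antisymmetric vector `x ⊗
y - y ⊗ x`, which does not depend on `φ`, while `⟨x, ρA x⟩` and `⟨x, ρB x⟩` are half the two
radicands in `gFun`. Cauchy-Schwarz then gives `gFun s r θ φ ≤ tr (C R)` for every coupling and
every `φ` (`gFun_le_of_mem_costs`).

Equality suggests a coupling without `x ⊗ x` component: a rank-one part `w = P x⊗y + Q y⊗x + k y⊗y`
plus a multiple of the projection onto `y ⊗ y` (`half_sq_sub_mem_costs`). Its marginals are correct
when one `k` matches both off-diagonal entries, which is the first-order condition for a maximum of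
`gFun`. Positivity needs `P² + Q² + k² ≤ 1`, which follows from global maximality
(`exists_multiplier_of_maximum`). Both sides of the trigonometric equation are the square of the
common multiplier, so the maximizing angle lies in `PhiSet`. -/

lemma natDegree_phiPoly_le (s r θ : ℝ) : (phiPoly s r θ).natDegree ≤ 6 := by
  have h (a : ℂ) : (C a * (X ^ 2 + 1) + 2 * X).natDegree ≤ 2 := by compute_degree
  have h1 (a b c : ℂ) : (C a * (C b * X ^ 2 + 1) + C c * X).natDegree ≤ 2 := by compute_degree
  have h2 (a : ℂ) : ((C a * X ^ 2 - 1) ^ 2).natDegree ≤ 2 * 2 :=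
    natDegree_pow_le_of_le 2 (by compute_degree)
  have h3 : ((X ^ 2 - 1 : ℂ[X]) ^ 2).natDegree ≤ 2 * 2 :=
    natDegree_pow_le_of_le 2 (by compute_degree)
  exact natDegree_sub_le_of_le
    (natDegree_mul_le_of_le ((natDegree_C_mul_le _ _).trans (h _)) (h2 _))
    (natDegree_mul_le_of_le ((natDegree_C_mul_le _ _).trans h3) (h1 _ _ _))

lemma phiPoly_eval (s r θ : ℝ) (z : ℂ) :
    (phiPoly s r θ).eval z =
      (1 - 2 * r) ^ 2 * ((2 * s - 1) * (z ^ 2 + 1) + 2 * z)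
          * (Complex.exp (θ * Complex.I) ^ 2 * z ^ 2 - 1) ^ 2
        - Complex.exp (θ * Complex.I) * (1 - 2 * s) ^ 2 * (z ^ 2 - 1) ^ 2
          * ((2 * r - 1) * (Complex.exp (θ * Complex.I) ^ 2 * z ^ 2 + 1)
            + 2 * Complex.exp (θ * Complex.I) * z) := by
  simp [phiPoly]

lemma exp_sq_add_one (φ : ℝ) :
    Complex.exp (φ * Complex.I) ^ 2 + 1 = 2 * Real.cos φ * Complex.exp (φ * Complex.I) := by
  have h : (Real.sin φ : ℂ) ^ 2 + (Real.cos φ : ℂ) ^ 2 = 1 := by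
    exact_mod_cast Real.sin_sq_add_cos_sq φ
  rw [Complex.exp_mul_I, ← Complex.ofReal_cos, ← Complex.ofReal_sin]
  linear_combination (-1 : ℂ) * h + (Real.sin φ : ℂ) ^ 2 * Complex.I_sq

lemma exp_sq_sub_one (φ : ℝ) :
    Complex.exp (φ * Complex.I) ^ 2 - 1 =
      2 * Complex.I * Real.sin φ * Complex.exp (φ * Complex.I) := by
  have h : (Real.sin φ : ℂ) ^ 2 + (Real.cos φ : ℂ) ^ 2 = 1 := by
    exact_mod_cast Real.sin_sq_add_cos_sq φ
  rw [Complex.exp_mul_I, ← Complex.ofReal_cos, ← Complex.ofReal_sin]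
  linear_combination h - (Real.sin φ : ℂ) ^ 2 * Complex.I_sq

/-- On the unit circle `z² + 1 = 2 z cos φ` and `z² - 1 = 2 i z sin φ`, and likewise for `ζ z` with
angle `θ + φ`. The cross-multiplied equation thus appears times a nonvanishing factor. -/
lemma phiPoly_eval_exp (s r θ φ : ℝ) :
    (phiPoly s r θ).eval (Complex.exp (φ * Complex.I)) =
      8 * Complex.exp (θ * Complex.I) ^ 2 * Complex.exp (φ * Complex.I) ^ 3
        * (((2 * s - 1) ^ 2 * Real.sin φ ^ 2 * (1 + (2 * r - 1) * Real.cos (θ + φ))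
          - (2 * r - 1) ^ 2 * Real.sin (θ + φ) ^ 2 * (1 + (2 * s - 1) * Real.cos φ) : ℝ) : ℂ) := by
  have hadd : Complex.exp ((θ + φ : ℝ) * Complex.I) =
      Complex.exp (θ * Complex.I) * Complex.exp (φ * Complex.I) := by
    rw [← Complex.exp_add]; push_cast; ring_nf
  have h1 := exp_sq_add_one φ
  have h2 := exp_sq_sub_one φ
  have h3 := exp_sq_add_one (θ + φ)
  have h4 := exp_sq_sub_one (θ + φ)
  rw [hadd, mul_pow] at h3 h4
  rw [phiPoly_eval, h1, h2, h3, h4]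
  push_cast
  generalize Complex.exp (θ * Complex.I) = ζ
  generalize Complex.exp (φ * Complex.I) = z
  linear_combination
    (8 * ζ ^ 2 * z ^ 3 * (2 * r - 1) ^ 2 * Complex.sin (θ + φ) ^ 2
        * (1 + (2 * s - 1) * Complex.cos φ)
      - 8 * ζ ^ 2 * z ^ 3 * (2 * s - 1) ^ 2 * Complex.sin φ ^ 2
        * (1 + (2 * r - 1) * Complex.cos (θ + φ))) * Complex.I_sq

lemma one_add_mul_cos_pos {s : ℝ} (hs : 0 < s ∧ s < 1) (φ : ℝ) :
    0 < 1 + (2 * s - 1) * Real.cos φ := by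
  have h1 := Real.neg_one_le_cos φ
  have h2 := Real.cos_le_one φ
  nlinarith [mul_nonneg hs.1.le (sub_nonneg.2 h1),
    mul_nonneg (sub_nonneg.2 hs.2.le) (sub_nonneg.2 h2)]

lemma phiEquation_iff_eval_eq_zero {s r : ℝ} (hs : 0 < s ∧ s < 1) (hr : 0 < r ∧ r < 1)
    (θ φ : ℝ) :
    PhiEquation s r θ φ ↔ (phiPoly s r θ).eval (Complex.exp (φ * Complex.I)) = 0 := by
  rw [phiPoly_eval_exp, PhiEquation,
    div_eq_div_iff (one_add_mul_cos_pos hs φ).ne' (one_add_mul_cos_pos hr _).ne', mul_eq_zero,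
    or_iff_right (by simp [Complex.exp_ne_zero]), Complex.ofReal_eq_zero, sub_eq_zero]

lemma encard_phiSet_le {s r : ℝ} (hs : 0 < s ∧ s < 1) (hr : 0 < r ∧ r < 1) (θ : ℝ)
    (hP : phiPoly s r θ ≠ 0) : (PhiSet s r θ).encard ≤ 6 := by
  have hinj : Set.InjOn (fun φ : ℝ => Complex.exp (φ * Complex.I)) (PhiSet s r θ) := by
    intro φ hφ ψ hψ h
    obtain ⟨n, hn⟩ := Complex.exp_eq_exp_iff_exists_int.1 h
    have hn' : φ = ψ + n * (2 * Real.pi) := by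
      have := congrArg Complex.im hn
      simpa using this
    have hφ' := hφ.1
    have hψ' := hψ.1
    have hpi := Real.pi_pos
    have h1 : (n : ℝ) < 1 := by
      by_contra! hc
      nlinarith [hφ'.2, hψ'.1]
    have h2 : (-1 : ℝ) < n := by
      by_contra! hc
      nlinarith [hφ'.1, hψ'.2]
    have h3 : n = 0 := by
      have h1' : n < 1 := by exact_mod_cast h1
      have h2' : -1 < n := by exact_mod_cast h2
      omega
    simpa [h3] using hn'
  rw [← hinj.encard_image]
  have hsub : (fun φ : ℝ => Complex.exp (φ * Complex.I)) '' PhiSet s r θ ⊆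
      ((phiPoly s r θ).roots.toFinset : Set ℂ) := by
    rintro _ ⟨φ, hφ, rfl⟩
    simpa [hP] using (phiEquation_iff_eval_eq_zero hs hr θ φ).1 hφ.2
  refine (Set.encard_le_encard hsub).trans ?_
  rw [Set.encard_coe_eq_coe_finsetCard]
  exact_mod_cast (Multiset.toFinset_card_le _).trans
    ((card_roots' _).trans (natDegree_phiPoly_le s r θ))

lemma qubit_eq (r θ : ℝ) :
    qubit r θ = !![(((1 + (2 * r - 1) * Real.cos θ) / 2 : ℝ) : ℂ),
        (((2 * r - 1) * Real.sin θ / 2 : ℝ) : ℂ);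
      (((2 * r - 1) * Real.sin θ / 2 : ℝ) : ℂ),
        (((1 - (2 * r - 1) * Real.cos θ) / 2 : ℝ) : ℂ)] := by
  have h := Real.sin_sq_add_cos_sq (θ / 2)
  have hc : Real.cos θ = 2 * Real.cos (θ / 2) ^ 2 - 1 := by
    rw [← Real.cos_two_mul]; ring_nf
  have hs : Real.sin θ = 2 * Real.sin (θ / 2) * Real.cos (θ / 2) := by
    rw [← Real.sin_two_mul]; ring_nf
  rw [hc, hs]
  ext i j
  fin_cases i <;> fin_cases j <;>
    simp only [qubit, rot, Matrix.map_apply, Matrix.mul_apply, Fin.sum_univ_two,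
      Matrix.transpose_apply, Matrix.of_apply, Matrix.cons_val', Matrix.cons_val_zero,
      Matrix.cons_val_one, Matrix.cons_val_fin_one, Fin.zero_eta, Fin.mk_one, Fin.isValue] <;>
    congr 1 <;> generalize Real.sin (θ / 2) = S at * <;>
    generalize Real.cos (θ / 2) = K at *
  · linear_combination (1 - r) * h
  · ring
  · ring
  · linear_combination r * h

lemma qubit_eq_of_sin_cos {s r θ : ℝ} (hc : 2 * s - 1 = (2 * r - 1) * Real.cos θ)
    (hs : (2 * r - 1) * Real.sin θ = 0) : qubit s 0 = qubit r θ := by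
  rw [qubit_eq, qubit_eq, hs, ← hc]
  simp

lemma phiPoly_ne_zero {s r θ : ℝ} (h : qubit s 0 ≠ qubit r θ) : phiPoly s r θ ≠ 0 := by
  intro h0
  apply h
  set ζ := Complex.exp (θ * Complex.I) with hζ
  have hζ0 : ζ ≠ 0 := Complex.exp_ne_zero _
  have hev : ∀ z : ℂ, (1 - 2 * r : ℂ) ^ 2 * ((2 * s - 1) * (z ^ 2 + 1) + 2 * z)
          * (ζ ^ 2 * z ^ 2 - 1) ^ 2
        - ζ * (1 - 2 * s) ^ 2 * (z ^ 2 - 1) ^ 2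
          * ((2 * r - 1) * (ζ ^ 2 * z ^ 2 + 1) + 2 * ζ * z) = 0 := by
    intro z
    rw [← phiPoly_eval, h0, eval_zero]
  have e0 := hev 0
  have e1 := hev 1
  have e1' := hev (-1)
  have e2 := hev 2
  -- At `z = ±1` the second summand of the polynomial vanishes, and the difference of the two values
  -- isolates `(2r - 1)² (ζ² - 1)²`.
  have hb : (2 * r - 1 : ℂ) = 0 ∨ ζ ^ 2 = 1 := by
    have : (2 * r - 1 : ℂ) * (ζ ^ 2 - 1) = 0 := by
      refine pow_eq_zero_iff two_ne_zero |>.1 ?_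
      linear_combination (e1 - e1') / 4
    exact (mul_eq_zero.1 this).imp_right sub_eq_zero.1
  rcases hb with hb | hζ2
  · have ha : (2 * s - 1 : ℂ) = 0 := by
      have : ζ * (2 * s - 1 : ℂ) = 0 := by
        refine pow_eq_zero_iff two_ne_zero |>.1 ?_
        have hb' : (r : ℂ) = 1 / 2 := by linear_combination hb / 2
        rw [hb'] at e2
        linear_combination -e2 / 36
      exact (mul_eq_zero.1 this).resolve_left hζ0
    have ha' : 2 * s - 1 = 0 := by exact_mod_cast ha
    have hb' : 2 * r - 1 = 0 := by exact_mod_cast hb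
    exact qubit_eq_of_sin_cos (by simp [ha', hb']) (by simp [hb'])
  · have key : (2 * s - 1 : ℂ) = (2 * r - 1) * ζ := by
      have hsq : (2 * s - 1 : ℂ) ^ 2 = (2 * r - 1) ^ 2 := by
        have e2' : (1 - 2 * r : ℂ) ^ 2 * (5 * (2 * s - 1) + 4) * 9
            - ζ * (1 - 2 * s) ^ 2 * 9 * (5 * (2 * r - 1)) - 36 * (1 - 2 * s) ^ 2 = 0 := by
          rw [hζ2] at e2
          linear_combination e2 + 36 * (1 - 2 * s : ℂ) ^ 2 * hζ2
        linear_combination -e2' / 36 + 5 / 4 * e0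
      have hm : (2 * s - 1 : ℂ) ^ 2 * ((2 * s - 1) - (2 * r - 1) * ζ) = 0 := by
        linear_combination (2 * s - 1 : ℂ) * hsq + e0
      rcases mul_eq_zero.1 hm with h1 | h1
      · have ha : (2 * s - 1 : ℂ) = 0 := pow_eq_zero_iff two_ne_zero |>.1 h1
        have hb : (2 * r - 1 : ℂ) = 0 := pow_eq_zero_iff two_ne_zero |>.1 (by rw [← hsq, h1])
        rw [ha, hb, zero_mul]
      · exact sub_eq_zero.1 h1
    -- The real and imaginary parts of this identity say that the Bloch vectors of the two states
    -- agree.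
    have hkey : (((2 * s - 1 : ℝ)) : ℂ) = ((2 * r - 1 : ℝ) : ℂ) * ζ := by
      push_cast; exact key
    have hre := congrArg Complex.re hkey
    have him := congrArg Complex.im hkey
    rw [Complex.re_ofReal_mul, hζ, Complex.exp_ofReal_mul_I_re, Complex.ofReal_re] at hre
    rw [Complex.im_ofReal_mul, hζ, Complex.exp_ofReal_mul_I_im, Complex.ofReal_im] at him
    exact qubit_eq_of_sin_cos hre him.symm

end Polynomial

/-! ### Lower bound for the cost of every coupling. -/

lemma swapCost_mul_trace (R : Matrix (Fin 2 × Fin 2) (Fin 2 × Fin 2) ℂ) :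
    (swapCost (Fin 2) * R).trace =
      (R (0, 1) (0, 1) + R (1, 0) (1, 0) - R (0, 1) (1, 0) - R (1, 0) (0, 1)) / 2 := by
  simp [Matrix.trace, Matrix.mul_apply, Fintype.sum_prod_type, swapCost, swapMatrix,
    Matrix.one_apply]
  ring

/-- A positive semidefinite form has `Z² ≤ X Y` and `2 Z ≤ X + Y`, hence `(Z + t)² ≤ (X + t)(Y +
t)`; expanding the square on the left finishes. -/
lemma sq_sqrt_sub_sqrt_le {X Y Z t : ℝ}
    (h : ∀ l m : ℝ, 0 ≤ l ^ 2 * X + 2 * l * m * Z + m ^ 2 * Y) (ht : 0 ≤ t) :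
    (√(2 * (X + t)) - √(2 * (Y + t))) ^ 2 ≤ 2 * (X + Y - 2 * Z) := by
  have hX : 0 ≤ X := by simpa using h 1 0
  have hY : 0 ≤ Y := by simpa using h 0 1
  have hXY : 2 * Z ≤ X + Y := by linarith [h 1 (-1)]
  have hZ : Z ^ 2 ≤ X * Y := by
    have h1 := h Z (-X)
    have h2 := h Y (-Z)
    have h3 := h 1 1
    by_contra! hc
    have hX0 : X = 0 := by nlinarith
    have hY0 : Y = 0 := by nlinarith
    have hZ0 : Z = 0 := by linarith
    simp [hX0, hZ0] at hc
  have hmul : 2 * (Z + t) ≤ √(2 * (X + t)) * √(2 * (Y + t)) := by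
    rw [← Real.sqrt_mul (by positivity)]
    apply Real.le_sqrt_of_sq_le
    nlinarith
  have h1 := Real.sq_sqrt (show 0 ≤ 2 * (X + t) by positivity)
  have h2 := Real.sq_sqrt (show 0 ≤ 2 * (Y + t) by positivity)
  nlinarith

lemma gFun_le_of_mem_costs {s r θ c : ℝ}
    (hc : c ∈ costs (swapCost (Fin 2)) (qubit s 0) (qubit r θ)) (φ : ℝ) :
    gFun s r θ φ ≤ c := by
  obtain ⟨R, ⟨⟨hR, -⟩, hB, hA⟩, rfl⟩ := hc
  have hsym (i j) : (R j i).re = (R i j).re := by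
    rw [← hR.1.apply i j]; simp
  have hQ (v : Fin 2 × Fin 2 → ℝ) : 0 ≤ ∑ i, ∑ j, v i * v j * (R i j).re := by
    have := (Complex.le_def.1 (hR.dotProduct_mulVec_nonneg (fun i => (v i : ℂ)))).1
    simpa [dotProduct, Matrix.mulVec, Finset.mul_sum, mul_assoc, mul_comm,
      mul_left_comm] using this
  have hB' (i j) := congrArg Complex.re (congrFun (congrFun hB i) j)
  have hA' (i j) := congrArg Complex.re (congrFun (congrFun hA i) j)
  have b00 := hB' 0 0
  have b01 := hB' 0 1
  have b11 := hB' 1 1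
  have a00 := hA' 0 0
  have a01 := hA' 0 1
  have a11 := hA' 1 1
  simp only [traceB, traceA, qubit_eq, Matrix.of_apply, Fin.sum_univ_two, Matrix.cons_val',
    Matrix.cons_val_zero, Matrix.cons_val_one, Matrix.cons_val_fin_one, Complex.add_re,
    Complex.ofReal_re, Real.cos_zero, Real.sin_zero] at b00 b01 b11 a00 a01 a11
  have hφ : 2 * (φ / 2) = φ := by ring
  have hcos : Real.cos φ = Real.cos (φ / 2) ^ 2 - Real.sin (φ / 2) ^ 2 := by
    rw [← Real.cos_two_mul', hφ]
  have hsin : Real.sin φ = 2 * Real.sin (φ / 2) * Real.cos (φ / 2) := by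
    rw [← Real.sin_two_mul, hφ]
  have hone := Real.sin_sq_add_cos_sq (φ / 2)
  set S := Real.sin (φ / 2)
  set K := Real.cos (φ / 2)
  simp only [Fintype.sum_prod_type, Fin.sum_univ_two] at hQ
  -- Test vectors `x ⊗ x`, and `l x⊗y + m y⊗x`, for the rotated basis `x = (K, -S)`, `y = (S, K)`.
  have ht := hQ (fun i => ![K, -S] i.1 * ![K, -S] i.2)
  have hlm (l m : ℝ) := hQ (fun i => l * (![K, -S] i.1 * ![S, K] i.2)
    + m * (![S, K] i.1 * ![K, -S] i.2))
  simp only [Matrix.cons_val_zero, Matrix.cons_val_one, Matrix.cons_val_fin_one] at ht hlm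
  rw [hsym (0, 0) (0, 1), hsym (0, 0) (1, 0), hsym (0, 0) (1, 1), hsym (0, 1) (1, 0),
    hsym (0, 1) (1, 1), hsym (1, 0) (1, 1)] at ht
  simp only [hsym (0, 0) (0, 1), hsym (0, 0) (1, 0), hsym (0, 0) (1, 1), hsym (0, 1) (1, 0),
    hsym (0, 1) (1, 1), hsym (1, 0) (1, 1)] at hlm
  beta_reduce
  rw [swapCost_mul_trace, gFun, Real.cos_add, hcos, hsin]
  have hcost : ((R (0, 1) (0, 1) + R (1, 0) (1, 0) - R (0, 1) (1, 0) - R (1, 0) (0, 1)) / 2).re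
      = ((R (0, 1) (0, 1)).re + (R (1, 0) (1, 0)).re - 2 * (R (0, 1) (1, 0)).re) / 2 := by
    simp [hsym (0, 1) (1, 0)]
    ring
  rw [hcost]
  generalize (R (0, 0) (0, 0)).re = m00 at *
  generalize (R (0, 0) (0, 1)).re = m01 at *
  generalize (R (0, 0) (1, 0)).re = m02 at *
  generalize (R (0, 0) (1, 1)).re = m03 at *
  generalize (R (0, 1) (0, 1)).re = m11 at *
  generalize (R (0, 1) (1, 0)).re = m12 at *
  generalize (R (0, 1) (1, 1)).re = m13 at *
  generalize (R (1, 0) (1, 0)).re = m22 at *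
  generalize (R (1, 0) (1, 1)).re = m23 at *
  generalize (R (1, 1) (1, 1)).re = m33 at *
  -- `X`, `Y`, `t` are the diagonal entries of the real part of `R` at `x⊗y`, `y⊗x`, `x⊗x`, and `Z`
  -- is its entry between `x⊗y` and `y⊗x`.
  obtain ⟨X, hX⟩ : ∃ X, X = S ^ 2 * K ^ 2 * m00 + K ^ 4 * m11 + S ^ 4 * m22 + S ^ 2 * K ^ 2 * m33 + 2 * (S * K ^ 3 * m01
      - S ^ 3 * K * m02 - S ^ 2 * K ^ 2 * m03 - S ^ 2 * K ^ 2 * m12 - S * K ^ 3 * m13 + S ^ 3 * K * m23) := ⟨_, rfl⟩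
  obtain ⟨Y, hY⟩ : ∃ Y, Y = S ^ 2 * K ^ 2 * m00 + S ^ 4 * m11 + K ^ 4 * m22 + S ^ 2 * K ^ 2 * m33 + 2 * (-S ^ 3 * K * m01
      + S * K ^ 3 * m02 - S ^ 2 * K ^ 2 * m03 - S ^ 2 * K ^ 2 * m12 + S ^ 3 * K * m13 - S * K ^ 3 * m23) := ⟨_, rfl⟩
  obtain ⟨Z, hZ⟩ : ∃ Z, Z = S ^ 2 * K ^ 2 * m00 - S ^ 2 * K ^ 2 * m11 - S ^ 2 * K ^ 2 * m22 + S ^ 2 * K ^ 2 * m33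
      + (S * K ^ 3 - S ^ 3 * K) * m01 + (S * K ^ 3 - S ^ 3 * K) * m02 - 2 * S ^ 2 * K ^ 2 * m03
      + (K ^ 4 + S ^ 4) * m12 + (S ^ 3 * K - S * K ^ 3) * m13 + (S ^ 3 * K - S * K ^ 3) * m23 := ⟨_, rfl⟩
  obtain ⟨t, ht'⟩ : ∃ t, t = K ^ 4 * m00 + S ^ 2 * K ^ 2 * (m11 + m22 + 2 * m12) + S ^ 4 * m33 + 2 * (-S * K ^ 3 * (m01 + m02)
      + S ^ 2 * K ^ 2 * m03 - S ^ 3 * K * (m13 + m23)) := ⟨_, rfl⟩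
  have hlm' (l m : ℝ) : 0 ≤ l ^ 2 * X + 2 * l * m * Z + m ^ 2 * Y := by
    refine (hlm l m).trans_eq ?_
    rw [hX, hY, hZ]
    ring
  have ht0 : 0 ≤ t := by
    refine ht.trans_eq ?_
    rw [ht']
    ring
  have hu : 2 * (X + t) = 1 + (2 * s - 1) * (K ^ 2 - S ^ 2) := by
    rw [hX, ht']
    linear_combination 2 * K ^ 2 * (S ^ 2 + K ^ 2) * b00 - 4 * K * S * (S ^ 2 + K ^ 2) * b01
      + 2 * S ^ 2 * (S ^ 2 + K ^ 2) * b11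
      + (S ^ 2 + K ^ 2 + 1 + (2 * s - 1) * (K ^ 2 - S ^ 2)) * hone
  have hv : 2 * (Y + t) = 1 + (2 * r - 1) *
      (Real.cos θ * (K ^ 2 - S ^ 2) - Real.sin θ * (2 * S * K)) := by
    rw [hY, ht']
    linear_combination 2 * K ^ 2 * (S ^ 2 + K ^ 2) * a00 - 4 * K * S * (S ^ 2 + K ^ 2) * a01
      + 2 * S ^ 2 * (S ^ 2 + K ^ 2) * a11
      + (S ^ 2 + K ^ 2 + 1 + (2 * r - 1) *
        (Real.cos θ * (K ^ 2 - S ^ 2) - Real.sin θ * (2 * S * K))) * hone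
  have hw : X + Y - 2 * Z = m11 + m22 - 2 * m12 := by
    rw [hX, hY, hZ]
    linear_combination (m11 + m22 - 2 * m12) * (S ^ 2 + K ^ 2 + 1) * hone
  have key := sq_sqrt_sub_sqrt_le hlm' ht0
  rw [hu, hv, hw] at key
  linarith

/-! ### Couplings that attain the bound. -/

lemma half_sq_sub_mem_costs {s r θ φ P Q k : ℝ}
    (hP : 2 * P ^ 2 = 1 + (2 * s - 1) * Real.cos φ)
    (hQ : 2 * Q ^ 2 = 1 + (2 * r - 1) * Real.cos (θ + φ))
    (hPk : (2 * s - 1) * Real.sin φ = 2 * k * P)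
    (hQk : (2 * r - 1) * Real.sin (θ + φ) = 2 * k * Q)
    (hk : P ^ 2 + Q ^ 2 + k ^ 2 ≤ 1) :
    (P - Q) ^ 2 / 2 ∈ costs (swapCost (Fin 2)) (qubit s 0) (qubit r θ) := by
  have hφ : 2 * (φ / 2) = φ := by ring
  have hcos : Real.cos φ = Real.cos (φ / 2) ^ 2 - Real.sin (φ / 2) ^ 2 := by
    rw [← Real.cos_two_mul', hφ]
  have hsin : Real.sin φ = 2 * Real.sin (φ / 2) * Real.cos (φ / 2) := by
    rw [← Real.sin_two_mul, hφ]
  have hone := Real.sin_sq_add_cos_sq (φ / 2)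
  -- The hypotheses give the Bloch vectors in the frame turned by `φ`; these four identities turn
  -- them back.
  have hA0 : (2 * s - 1) = (2 * P ^ 2 - 1) * Real.cos φ + 2 * k * P * Real.sin φ := by
    linear_combination Real.cos φ * -hP + Real.sin φ * hPk
      - (2 * s - 1) * Real.sin_sq_add_cos_sq φ
  have hA1 : 0 = 2 * k * P * Real.cos φ - (2 * P ^ 2 - 1) * Real.sin φ := by
    linear_combination Real.sin φ * hP + Real.cos φ * hPk
  have hB0 : (2 * r - 1) * Real.cos θ =
      (2 * Q ^ 2 - 1) * Real.cos φ + 2 * k * Q * Real.sin φ := by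
    rw [Real.cos_add] at hQ
    rw [Real.sin_add] at hQk
    linear_combination Real.cos φ * -hQ + Real.sin φ * hQk
      - (2 * r - 1) * Real.cos θ * Real.sin_sq_add_cos_sq φ
  have hB1 : (2 * r - 1) * Real.sin θ =
      2 * k * Q * Real.cos φ - (2 * Q ^ 2 - 1) * Real.sin φ := by
    rw [Real.cos_add] at hQ
    rw [Real.sin_add] at hQk
    linear_combination Real.sin φ * hQ + Real.cos φ * hQk
      - (2 * r - 1) * Real.sin θ * Real.sin_sq_add_cos_sq φ
  rw [hcos, hsin] at hA0 hA1 hB0 hB1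
  set S := Real.sin (φ / 2)
  set K := Real.cos (φ / 2)
  set x : Fin 2 → ℝ := ![K, -S] with hx
  set y : Fin 2 → ℝ := ![S, K] with hy
  set w : Fin 2 × Fin 2 → ℂ := fun i =>
    ((P * (x i.1 * y i.2) + Q * (y i.1 * x i.2) + k * (y i.1 * y i.2) : ℝ) : ℂ) with hw
  set f : Fin 2 × Fin 2 → ℂ := fun i => ((y i.1 * y i.2 : ℝ) : ℂ) with hf
  set R := Matrix.vecMulVec w (star w)
    + ((1 - P ^ 2 - Q ^ 2 - k ^ 2 : ℝ) : ℂ) • Matrix.vecMulVec f (star f) with hRdef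
  have hR : R.PosSemidef :=
    (Matrix.posSemidef_vecMulVec_self_star w).add
      ((Matrix.posSemidef_vecMulVec_self_star f).smul
        (by exact_mod_cast (by linarith : (0 : ℝ) ≤ 1 - P ^ 2 - Q ^ 2 - k ^ 2)))
  have hRe (i j) : R i j = (((P * (x i.1 * y i.2) + Q * (y i.1 * x i.2) + k * (y i.1 * y i.2))
      * (P * (x j.1 * y j.2) + Q * (y j.1 * x j.2) + k * (y j.1 * y j.2))
      + (1 - P ^ 2 - Q ^ 2 - k ^ 2) * ((y i.1 * y i.2) * (y j.1 * y j.2)) : ℝ) : ℂ) := by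
    simp [hRdef, hw, hf, Matrix.vecMulVec_apply]
  have hBt : traceB R = qubit s 0 := by
    rw [qubit_eq]
    ext i j
    fin_cases i <;> fin_cases j <;>
      simp only [traceB, Matrix.of_apply, Fin.sum_univ_two, hRe, hx, hy, Matrix.cons_val',
        Matrix.cons_val_zero, Matrix.cons_val_one, Matrix.cons_val_fin_one, Fin.zero_eta,
        Fin.mk_one, Fin.isValue, Real.cos_zero, Real.sin_zero, mul_one, mul_zero,
        ← Complex.ofReal_add, Complex.ofReal_inj]
    · linear_combination (P ^ 2 * K ^ 2 + (1 - P ^ 2) * S ^ 2 + 2 * k * P * K * S + 1 / 2) * hone - hA0 / 2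
    · linear_combination ((1 - 2 * P ^ 2) * S * K + k * P * (K ^ 2 - S ^ 2)) * hone - hA1 / 2
    · linear_combination ((1 - 2 * P ^ 2) * S * K + k * P * (K ^ 2 - S ^ 2)) * hone - hA1 / 2
    · linear_combination (P ^ 2 * S ^ 2 + (1 - P ^ 2) * K ^ 2 - 2 * k * P * K * S + 1 / 2) * hone + hA0 / 2
  have hAt : traceA R = qubit r θ := by
    rw [qubit_eq]
    ext i j
    fin_cases i <;> fin_cases j <;>
      simp only [traceA, Matrix.of_apply, Fin.sum_univ_two, hRe, hx, hy, Matrix.cons_val',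
        Matrix.cons_val_zero, Matrix.cons_val_one, Matrix.cons_val_fin_one, Fin.zero_eta,
        Fin.mk_one, Fin.isValue, ← Complex.ofReal_add, Complex.ofReal_inj]
    · linear_combination (Q ^ 2 * K ^ 2 + (1 - Q ^ 2) * S ^ 2 + 2 * k * Q * K * S + 1 / 2) * hone - hB0 / 2
    · linear_combination ((1 - 2 * Q ^ 2) * S * K + k * Q * (K ^ 2 - S ^ 2)) * hone - hB1 / 2
    · linear_combination ((1 - 2 * Q ^ 2) * S * K + k * Q * (K ^ 2 - S ^ 2)) * hone - hB1 / 2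
    · linear_combination (Q ^ 2 * S ^ 2 + (1 - Q ^ 2) * K ^ 2 - 2 * k * Q * K * S + 1 / 2) * hone + hB0 / 2
  have htr : R.trace = 1 := by
    have h : R.trace = (traceB R).trace := by
      simp [Matrix.trace, traceB, Fintype.sum_prod_type]
    rw [h, hBt, qubit_eq, Matrix.trace_fin_two_of, ← Complex.ofReal_add, Complex.ofReal_eq_one]
    ring
  refine ⟨R, ⟨⟨hR, htr⟩, hBt, hAt⟩, ?_⟩
  beta_reduce
  rw [swapCost_mul_trace]
  simp only [hRe, hx, hy, Matrix.cons_val_zero, Matrix.cons_val_one, Matrix.cons_val_fin_one]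
  norm_cast
  linear_combination (P - Q) ^ 2 / 2 * (S ^ 2 + K ^ 2 + 1) * hone

/-- At a maximum of the difference of the seminorms of the two states over all directions, the
multiplier `k` of the two first-order conditions leaves room for the remaining diagonal entry. -/
lemma exists_multiplier_of_maximum {a b η θ φ : ℝ} (hu : ∀ ψ, 0 < 1 + a * Real.cos (η + ψ))
    (hv : ∀ ψ, 0 < 1 + b * Real.cos (θ + ψ))
    (hpos : √(1 + b * Real.cos (θ + φ)) < √(1 + a * Real.cos (η + φ)))
    (hmax : ∀ ψ, (√(1 + a * Real.cos (η + ψ)) - √(1 + b * Real.cos (θ + ψ))) ^ 2 ≤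
      (√(1 + a * Real.cos (η + φ)) - √(1 + b * Real.cos (θ + φ))) ^ 2) :
    ∃ k, a * Real.sin (η + φ) = k * √(1 + a * Real.cos (η + φ)) ∧
      b * Real.sin (θ + φ) = k * √(1 + b * Real.cos (θ + φ)) ∧
      (1 + a * Real.cos (η + φ)) + (1 + b * Real.cos (θ + φ)) + k ^ 2 ≤ 2 := by
  have hderiv (c ξ : ℝ) (h : 0 < 1 + c * Real.cos (ξ + φ)) :
      HasDerivAt (fun ψ => √(1 + c * Real.cos (ξ + ψ)))
        (-(c * Real.sin (ξ + φ)) / (2 * √(1 + c * Real.cos (ξ + φ)))) φ := by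
    have := ((((hasDerivAt_id φ).const_add ξ).cos.const_mul c).const_add 1).sqrt h.ne'
    simpa using this
  -- As the difference is positive at `φ`, maximality of its square gives maximality of the
  -- difference itself.
  have hmax' : IsLocalMax
      (fun ψ => √(1 + a * Real.cos (η + ψ)) - √(1 + b * Real.cos (θ + ψ))) φ :=
    Filter.Eventually.of_forall fun ψ =>
      (abs_le_of_sq_le_sq' (hmax ψ) (sub_pos.2 hpos).le).2
  have hcrit := hmax'.hasDerivAt_eq_zero ((hderiv a η (hu φ)).sub (hderiv b θ (hv φ)))
  have hU := Real.sqrt_pos.2 (hu φ)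
  have hV := Real.sqrt_pos.2 (hv φ)
  have hU2 := Real.sq_sqrt (hu φ).le
  have hV2 := Real.sq_sqrt (hv φ).le
  set U := √(1 + a * Real.cos (η + φ)) with hUdef
  set V := √(1 + b * Real.cos (θ + φ)) with hVdef
  have hk : a * Real.sin (η + φ) = a * Real.sin (η + φ) / U * U := by field_simp
  have hk' : b * Real.sin (θ + φ) = a * Real.sin (η + φ) / U * V := by
    field_simp at hcrit ⊢
    linarith
  set k := a * Real.sin (η + φ) / U
  refine ⟨k, hk, hk', ?_⟩
  set m := U + V with hm
  set N := √(k ^ 2 + m ^ 2) with hN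
  have hN2 : N ^ 2 = k ^ 2 + m ^ 2 := Real.sq_sqrt (by positivity)
  have hNpos : 0 < N := Real.sqrt_pos.2 (by positivity)
  -- The competing angle `φ + δ` has `x' = (k x - m y) / N`, the other direction for which `x' ⊗ x'`
  -- is orthogonal to `U x⊗y + V y⊗x + k y⊗y`. It is twice the argument of `k + i m`.
  obtain ⟨δ, hδc, hδs⟩ : ∃ δ, N ^ 2 * Real.cos δ = k ^ 2 - m ^ 2 ∧
      N ^ 2 * Real.sin δ = 2 * k * m := by
    have hne : (⟨k, m⟩ : ℂ) ≠ 0 := fun h => (by positivity : m ≠ 0) (congrArg Complex.im h)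
    have hnorm : ‖(⟨k, m⟩ : ℂ)‖ = N := by
      rw [Complex.norm_def, Complex.normSq_mk, hN, sq, sq]
    refine ⟨2 * Complex.arg ⟨k, m⟩, ?_, ?_⟩
    · rw [Real.cos_two_mul', Complex.cos_arg hne, Complex.sin_arg, hnorm]
      field_simp
    · rw [Real.sin_two_mul, Complex.cos_arg hne, Complex.sin_arg, hnorm]
      field_simp
  have hA : N ^ 2 * (1 + a * Real.cos (η + (φ + δ))) =
      (k * V) ^ 2 + m ^ 2 * (2 - U ^ 2 - k ^ 2) := by
    rw [← add_assoc, Real.cos_add]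
    linear_combination hN2 + a * Real.cos (η + φ) * hδc - a * Real.sin (η + φ) * hδs
      - (k ^ 2 - m ^ 2) * hU2 - 2 * k * m * hk - k ^ 2 * (m + V - U) * hm
  have hB : N ^ 2 * (1 + b * Real.cos (θ + (φ + δ))) =
      (k * U) ^ 2 + m ^ 2 * (2 - V ^ 2 - k ^ 2) := by
    rw [← add_assoc, Real.cos_add]
    linear_combination hN2 + b * Real.cos (θ + φ) * hδc - b * Real.sin (θ + φ) * hδs
      - (k ^ 2 - m ^ 2) * hV2 - 2 * k * m * hk' - k ^ 2 * (m + U - V) * hm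
  have hle := (abs_le_of_sq_le_sq' (hmax (φ + δ)) (sub_pos.2 hpos).le).1
  have hU'2 := Real.sq_sqrt (hu (φ + δ)).le
  have hV'2 := Real.sq_sqrt (hv (φ + δ)).le
  have hU'0 := Real.sqrt_nonneg (1 + a * Real.cos (η + (φ + δ)))
  have hV'0 := Real.sqrt_nonneg (1 + b * Real.cos (θ + (φ + δ)))
  set U' := √(1 + a * Real.cos (η + (φ + δ)))
  set V' := √(1 + b * Real.cos (θ + (φ + δ)))
  have hsq : V' ^ 2 ≤ (U' + (U - V)) ^ 2 := by gcongr; linarith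
  -- This says `V'² - U'² = U² - V²`. Together with `V' - U' ≤ U - V` from maximality it forces `V ≤
  -- U'`.
  have hdiff : N ^ 2 * (V' ^ 2 - U' ^ 2 - (U - V) ^ 2) = N ^ 2 * (2 * (U - V) * V) := by
    rw [hU'2, hV'2, mul_sub, mul_sub, hA, hB, hN2]
    ring
  have hdiff' := mul_left_cancel₀ (pow_ne_zero 2 hNpos.ne') hdiff
  have hVU : V ≤ U' := by
    have : (U - V) * V ≤ (U - V) * U' := by linarith
    exact le_of_mul_le_mul_left this (sub_pos.2 hpos)
  have hfin : N ^ 2 * V ^ 2 ≤ (k * V) ^ 2 + m ^ 2 * (2 - U ^ 2 - k ^ 2) := by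
    rw [← hA, ← hU'2]
    gcongr
  have : m ^ 2 * V ^ 2 ≤ m ^ 2 * (2 - U ^ 2 - k ^ 2) := by
    rw [hN2] at hfin
    linarith
  have := le_of_mul_le_mul_left this (by positivity)
  linarith

lemma gFun_eq_zero_forall {s r θ : ℝ} (hs : 0 < s ∧ s < 1) (hr : 0 < r ∧ r < 1)
    (h : ∀ φ, gFun s r θ φ ≤ 0) (φ : ℝ) :
    (2 * s - 1) * Real.cos φ = (2 * r - 1) * Real.cos (θ + φ) := by
  have h0 := h φ
  have h1 : (√(1 + (2 * s - 1) * Real.cos φ) - √(1 + (2 * r - 1) * Real.cos (θ + φ))) ^ 2 = 0 := by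
    apply le_antisymm _ (sq_nonneg _)
    rw [gFun] at h0
    linarith
  have h2 := sub_eq_zero.1 (pow_eq_zero_iff two_ne_zero |>.1 h1)
  rw [Real.sqrt_inj (one_add_mul_cos_pos hs φ).le (one_add_mul_cos_pos hr _).le] at h2
  linarith

lemma exists_maximizer_gFun (s r θ : ℝ) :
    ∃ φ ∈ Set.Ico 0 (2 * Real.pi), ∀ ψ, gFun s r θ ψ ≤ gFun s r θ φ := by
  have hper : Function.Periodic (gFun s r θ) (2 * Real.pi) := by
    intro φ
    simp only [gFun, ← add_assoc, Real.cos_add_two_pi]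
  have hcont : Continuous (gFun s r θ) := by
    unfold gFun
    fun_prop
  obtain ⟨φ, -, hφ⟩ := isCompact_Icc.exists_isMaxOn
    (Set.nonempty_Icc.2 Real.two_pi_pos.le) hcont.continuousOn
  obtain ⟨φ', hφ', he⟩ := hper.exists_mem_Ico₀ Real.two_pi_pos φ
  refine ⟨φ', hφ', fun ψ => ?_⟩
  obtain ⟨ψ', hψ', he'⟩ := hper.exists_mem_Ico₀ Real.two_pi_pos ψ
  rw [← he, he']
  exact hφ (Set.Ico_subset_Icc_self hψ')

lemma exists_multiplier {s r θ : ℝ} (hs : 0 < s ∧ s < 1) (hr : 0 < r ∧ r < 1) :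
    ∃ φ ∈ Set.Ico 0 (2 * Real.pi), ∃ k,
      (2 * s - 1) * Real.sin φ = k * √(1 + (2 * s - 1) * Real.cos φ) ∧
      (2 * r - 1) * Real.sin (θ + φ) = k * √(1 + (2 * r - 1) * Real.cos (θ + φ)) ∧
      (1 + (2 * s - 1) * Real.cos φ) + (1 + (2 * r - 1) * Real.cos (θ + φ)) + k ^ 2 ≤ 2 := by
  obtain ⟨φ, hφ, hmax⟩ := exists_maximizer_gFun s r θ
  have hu (ψ : ℝ) : 0 < 1 + (2 * s - 1) * Real.cos (0 + ψ) := one_add_mul_cos_pos hs _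
  have hv (ψ : ℝ) : 0 < 1 + (2 * r - 1) * Real.cos (θ + ψ) := one_add_mul_cos_pos hr _
  have hmax' (ψ : ℝ) :
      (√(1 + (2 * s - 1) * Real.cos (0 + ψ)) - √(1 + (2 * r - 1) * Real.cos (θ + ψ))) ^ 2 ≤
      (√(1 + (2 * s - 1) * Real.cos (0 + φ)) - √(1 + (2 * r - 1) * Real.cos (θ + φ))) ^ 2 := by
    have := hmax ψ
    simp only [gFun] at this
    simp only [zero_add]
    linarith
  rcases lt_trichotomy (√(1 + (2 * r - 1) * Real.cos (θ + φ)))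
    (√(1 + (2 * s - 1) * Real.cos (0 + φ))) with h | h | h
  · obtain ⟨k, h1, h2, h3⟩ := exists_multiplier_of_maximum hu hv h hmax'
    simp only [zero_add] at h1 h3
    exact ⟨φ, hφ, k, h1, h2, h3⟩
  -- A zero maximum makes the two radicands agree at every angle. Then `k = 0` works at `0` or `π`,
  -- whichever makes `(2s - 1) cos φ` nonpositive.
  · have h0 (ψ : ℝ) : gFun s r θ ψ ≤ 0 := by
      refine (hmax ψ).trans_eq ?_
      rw [zero_add] at h
      simp [gFun, h]
    have heq := gFun_eq_zero_forall hs hr h0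
    have hpi := Real.pi_pos
    have hc := heq 0
    have hsin := heq (Real.pi / 2)
    simp only [Real.cos_add_pi_div_two, Real.cos_pi_div_two, Real.cos_zero, add_zero] at hc hsin
    rcases le_total (2 * s - 1) 0 with hle | hle
    · refine ⟨0, ⟨le_rfl, by linarith⟩, 0, by simp, ?_, ?_⟩
      · rw [add_zero]; linarith
      · simp only [Real.cos_zero, add_zero]; linarith
    · refine ⟨Real.pi, ⟨hpi.le, by linarith⟩, 0, by simp, ?_, ?_⟩
      · rw [Real.sin_add_pi]; linarith
      · rw [Real.cos_pi, Real.cos_add_pi]; linarith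
  -- Same argument with the two states exchanged.
  · obtain ⟨k, h1, h2, h3⟩ := exists_multiplier_of_maximum hv hu h fun ψ => by
      have := hmax' ψ
      rw [sub_sq_comm, sub_sq_comm (√(1 + (2 * r - 1) * Real.cos (θ + φ)))]
      exact this
    simp only [zero_add] at h2 h3
    exact ⟨φ, hφ, k, h2, h1, by linarith⟩

end QuantumTransport

theorem theorem7p4 (s r θ : ℝ) (hs : 0 < s ∧ s < 1) (hr : 0 < r ∧ r < 1)
    (hθ : 0 ≤ θ ∧ θ < 2 * Real.pi) :
    -- the transport cost is an attained minimum over all couplings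
    IsLeast
      (QuantumTransport.costs (QuantumTransport.swapCost (Fin 2))
        (QuantumTransport.qubit s 0) (QuantumTransport.qubit r θ))
      (QuantumTransport.transportCost (QuantumTransport.swapCost (Fin 2))
        (QuantumTransport.qubit s 0) (QuantumTransport.qubit r θ)) ∧
    -- and it is the attained maximum over the solutions of the trigonometric equation
    IsGreatest
      (QuantumTransport.gFun s r θ '' QuantumTransport.PhiSet s r θ)
      (QuantumTransport.transportCost (QuantumTransport.swapCost (Fin 2))
        (QuantumTransport.qubit s 0) (QuantumTransport.qubit r θ)) ∧
    -- the trigonometric equation is a polynomial equation of degree at most six in exp (i φ)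
    (QuantumTransport.phiPoly s r θ).natDegree ≤ 6 ∧
    (∀ φ : ℝ, QuantumTransport.PhiEquation s r θ φ ↔
      (QuantumTransport.phiPoly s r θ).eval (Complex.exp (φ * Complex.I)) = 0) ∧
    -- with at most six solutions unless the two states coincide
    (QuantumTransport.qubit s 0 ≠ QuantumTransport.qubit r θ →
      QuantumTransport.phiPoly s r θ ≠ 0 ∧ (QuantumTransport.PhiSet s r θ).encard ≤ 6) := by
  open QuantumTransport in
  obtain ⟨φ, hφ, k, h1, h2, h3⟩ := exists_multiplier (θ := θ) hs hr
  have hu := one_add_mul_cos_pos hs φ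
  have hv := one_add_mul_cos_pos hr (θ + φ)
  have hU2 := Real.sq_sqrt hu.le
  have hV2 := Real.sq_sqrt hv.le
  have h20 : (√2 : ℝ) ≠ 0 := by positivity
  have h22 : (√2 : ℝ) ^ 2 = 2 := Real.sq_sqrt zero_le_two
  have hmem : gFun s r θ φ ∈ costs (swapCost (Fin 2)) (qubit s 0) (qubit r θ) := by
    -- Dividing by `√2` accounts for `2 P²` and `2 Q²` being the radicands.
    have h := half_sq_sub_mem_costs (s := s) (r := r) (θ := θ) (φ := φ)
      (P := √(1 + (2 * s - 1) * Real.cos φ) / √2)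
      (Q := √(1 + (2 * r - 1) * Real.cos (θ + φ)) / √2) (k := k / √2)
      (by rw [div_pow, hU2, h22]; ring) (by rw [div_pow, hV2, h22]; ring)
      (by rw [h1]; field_simp; rw [h22]) (by rw [h2]; field_simp; rw [h22])
      (by rw [div_pow, div_pow, div_pow, hU2, hV2, h22]; linarith)
    rw [← sub_div, div_pow, h22] at h
    convert h using 1
    rw [gFun]
    ring
  have hleast : IsLeast (costs (swapCost (Fin 2)) (qubit s 0) (qubit r θ)) (gFun s r θ φ) :=
    ⟨hmem, fun c hc => gFun_le_of_mem_costs hc φ⟩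
  have hT : transportCost (swapCost (Fin 2)) (qubit s 0) (qubit r θ) = gFun s r θ φ :=
    hleast.csInf_eq
  have hΦ : PhiEquation s r θ φ := by
    rw [PhiEquation, ← mul_pow, ← mul_pow, h1, h2, mul_pow, mul_pow, hU2, hV2,
      mul_div_cancel_right₀ _ hu.ne', mul_div_cancel_right₀ _ hv.ne']
  rw [hT]
  refine ⟨hleast, ⟨⟨φ, ⟨hφ, hΦ⟩, rfl⟩, ?_⟩, natDegree_phiPoly_le s r θ,
    phiEquation_iff_eval_eq_zero hs hr θ, fun h =>
      ⟨phiPoly_ne_zero h, encard_phiSet_le hs hr θ (phiPoly_ne_zero h)⟩⟩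
  rintro _ ⟨ψ, -, rfl⟩
  exact gFun_le_of_mem_costs hmem ψ
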